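/- Let $\mathcal X$ be a measurable space and let $\mathcal B\subset\{(b^{(1)},b^{(2)})\in\mathbb R^2 : 0\le b^{(2)}\le b^{(1)}\}$ be a set of pairs of first and second highest bids such that $M=\sup_{b\in\mathcal B}b^{(1)}$ is finite. For a reserve price $r\in\mathbb R$ and $b\in\mathcal B$ put $$L(r,b)=-\left(b^{(2)}\mathbf 1_{r<b^{(2)}}+r\,\mathbf 1_{b^{(2)}\le r\le b^{(1)}}\right).$$ Let $D$ be a probability distribution on $\mathcal X\times\mathcal B$, let $m\ge 1$, and let $S=((x_1,b_1),\dots,(x_m,b_m))$ be an i.i.d. sample drawn according to $D$. For measurable $h:\mathcal X\to\mathbb R$ put $\mathcal L(h)=\mathbb E_{(x,b)\sim D}[L(h(x),b)]$ and $\widehat{\mathcal L}_S(h)=\frac1m\sum_{i=1}^m L(h(x_i),b_i)$. Let $H$ be a set of measurable functions $h:\mathcal X\to\mathbb R$ (the suprema over $H$ of $\frac1m\sum_i\sigma_iL(h(x_i),b_i)$, for each sign vector $\sigma\in\{-1,1\}^m$, and of $\mathcal L(h)-\widehat{\mathcal L}_S(h)$ being assumed measurable as functions of the sample, up to null sets).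 Let $$\mathfrak R_m(H)=\mathbb E_{S\sim D^m}\,\mathbb E_{\sigma}\Big[\sup_{h\in H}\frac1m\sum_{i=1}^m\sigma_i h(x_i)\Big]\in[0,\infty],$$ where $\sigma_1,\dots,\sigma_m$ are independent and uniform on $\{-1,1\}$, and suppose that $H$ has finite pseudo-dimension $d$, that is, $d$ is the VC dimension of the family of sets $\{(x,t)\in\mathcal X\times\mathbb R: h(x)-t>0\}$, $h\in H$. Assume $d\le m$. Then for every $\delta>0$, with probability at least $1-\delta$ over the choice of $S$, every $h\in H$ satisfies $$\mathcal L(h)\le\widehat{\mathcal L}_S(h)+2\mathfrak R_m(H)+2M\sqrt{\frac{2d\log\frac{em}{d}}{m}}+M\sqrt{\frac{\log\frac1\delta}{2m}},$$ where $d\log\frac{em}{d}$ is read as $0$ when $d=0$. (For $\delta\ge 1$ the claim is empty.) -/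

import Mathlib

open MeasureTheory
open scoped ENNReal

noncomputable section

/-- Revenue of a second-price auction with reserve price `r`, where `b.1` is the highest bid
and `b.2` the second highest bid. -/
def auctionRevenue (r : ℝ) (b : ℝ × ℝ) : ℝ :=
  (if r < b.2 then b.2 else 0) + (if b.2 ≤ r ∧ r ≤ b.1 then r else 0)

/-- The loss of the reserve price `r` is the negative of the revenue. -/
def auctionLoss (r : ℝ) (b : ℝ × ℝ) : ℝ := -auctionRevenue r b

/-- The function `(x, b) ↦ L(h(x), b)` on feature vectors and bid pairs from `B`. -/
def lossOf {X : Type*} {B : Set (ℝ × ℝ)} (h : X → ℝ) (z : X × B) : ℝ :=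
  auctionLoss (h z.1) (z.2 : ℝ × ℝ)

/-- The expected loss of `h` under the distribution `D`. -/
def expectedLoss {X : Type*} [MeasurableSpace X] {B : Set (ℝ × ℝ)} (D : Measure (X × B))
    (h : X → ℝ) : ℝ :=
  ∫ z, lossOf h z ∂D

/-- The empirical loss of `h` on the sample `S` of size `m`. -/
def empiricalLoss {X : Type*} {B : Set (ℝ × ℝ)} {m : ℕ} (S : Fin m → X × B) (h : X → ℝ) : ℝ :=
  (1 / (m : ℝ)) * ∑ i, lossOf h (S i)

/-- The law of an i.i.d. sample of size `m` drawn from `D`. -/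
def sampleLaw {Z : Type*} [MeasurableSpace Z] (D : Measure Z) (m : ℕ) : Measure (Fin m → Z) :=
  Measure.pi fun _ => D

/-- The supremum over `g ∈ G` of `(1/m) ∑ σᵢ g(zᵢ)`, with values in the extended reals. -/
def signedSup {Z : Type*} (G : Set (Z → ℝ)) {m : ℕ} (S : Fin m → Z) (σ : Fin m → ℤˣ) : EReal :=
  ⨆ g ∈ G, (((1 / (m : ℝ)) * ∑ i, ((σ i : ℤ) : ℝ) * g (S i) : ℝ) : EReal)

/-- Empirical Rademacher complexity: the average of `signedSup G S σ` over the `2 ^ m` sign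
vectors `σ`. It is an extended real, equal to `⊤` when a supremum is infinite. -/
def empiricalRademacher {Z : Type*} (G : Set (Z → ℝ)) {m : ℕ} (S : Fin m → Z) : EReal :=
  ((((2 : ℝ) ^ m)⁻¹ : ℝ) : EReal) * ∑ σ : Fin m → ℤˣ, signedSup G S σ

/-- The empirical Rademacher complexity of a nonempty family is nonnegative, so nothing is lost
in regarding it as an element of `ℝ≥0∞`. -/
theorem empiricalRademacher_nonneg {Z : Type*} {G : Set (Z → ℝ)} (hG : G.Nonempty) {m : ℕ}
    (S : Fin m → Z) : 0 ≤ empiricalRademacher G S := by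
  obtain ⟨g, hg⟩ := hG
  refine mul_nonneg (by exact_mod_cast (by positivity : (0 : ℝ) ≤ ((2 : ℝ) ^ m)⁻¹)) ?_
  have key : (∑ σ : Fin m → ℤˣ, (1 / (m : ℝ)) * ∑ i, ((σ i : ℤ) : ℝ) * g (S i)) = 0 := by
    have h := Equiv.sum_comp (Equiv.neg (Fin m → ℤˣ))
      (fun σ => (1 / (m : ℝ)) * ∑ i, ((σ i : ℤ) : ℝ) * g (S i))
    simp only [Equiv.neg_apply, Pi.neg_apply, Units.val_neg, Int.cast_neg, neg_mul,
      Finset.sum_neg_distrib, mul_neg] at h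
    linarith
  calc (0 : EReal)
      = ((∑ σ : Fin m → ℤˣ, (1 / (m : ℝ)) * ∑ i, ((σ i : ℤ) : ℝ) * g (S i) : ℝ) : EReal) := by
        rw [key]; rfl
    _ = ∑ σ : Fin m → ℤˣ, (((1 / (m : ℝ)) * ∑ i, ((σ i : ℤ) : ℝ) * g (S i) : ℝ) : EReal) :=
        map_sum (⟨⟨((↑) : ℝ → EReal), EReal.coe_zero⟩, EReal.coe_add⟩ : ℝ →+ EReal) _ _
    _ ≤ ∑ σ : Fin m → ℤˣ, signedSup G S σ :=
        Finset.sum_le_sum fun σ _ => le_iSup₂_of_le g hg le_rfl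

/-- Rademacher complexity: the expectation of the empirical Rademacher complexity over an
i.i.d. sample of size `m`, as an element of `[0, ∞]`. -/
def rademacherComplexity {Z : Type*} [MeasurableSpace Z] (D : Measure Z) (m : ℕ)
    (G : Set (Z → ℝ)) : ℝ≥0∞ :=
  ∫⁻ S, (empiricalRademacher G S).toENNReal ∂(sampleLaw D m)

/-- The family of sets `C` shatters the finite set `A`. -/
def ShattersFinset {α : Type*} (C : Set (Set α)) (A : Finset α) : Prop :=
  ∀ B ⊆ A, ∃ c ∈ C, ∀ a ∈ A, a ∈ c ↔ a ∈ B

/-- The VC dimension: the supremum of the cardinalities of the finite shattered sets. -/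
def vcDimension {α : Type*} (C : Set (Set α)) : ℕ∞ :=
  ⨆ (A : Finset α) (_ : ShattersFinset C A), (A.card : ℕ∞)

/-- The pseudo-dimension of `H`: the VC dimension of the sets `{(x, t) | h(x) - t > 0}`,
`h ∈ H`. -/
def pseudoDimension {X : Type*} (H : Set (X → ℝ)) : ℕ∞ :=
  vcDimension ((fun h : X → ℝ => {p : X × ℝ | h p.1 - p.2 > 0}) '' H)

/-- The measurability needed for expectations and probabilities of suprema over `G` to make
sense, for samples of size `m`. -/
def HasMeasurableSuprema {Z : Type*} [MeasurableSpace Z] (D : Measure Z) (m : ℕ)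
    (G : Set (Z → ℝ)) : Prop :=
  (∀ σ : Fin m → ℤˣ, AEMeasurable (fun S : Fin m → Z => signedSup G S σ) (sampleLaw D m)) ∧
    AEMeasurable
      (fun S : Fin m → Z => ⨆ g ∈ G, ((∫ z, g z ∂D - (1 / (m : ℝ)) * ∑ i, g (S i) : ℝ) : EReal))
      (sampleLaw D m)

end

/-! The loss is discontinuous in the reserve price, so contraction does not apply to it directly. It
splits as `clippedLoss + jumpLoss`: the first part is 1-Lipschitz in the price, the second is the
highest bid times the indicator that the price exceeds it. On a fixed sample,
`contraction_principle` bounds the Rademacher average of the first part by that of `H`. For the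
second part, Sauer's lemma (`card_patterns_le`) limits the number of jump vectors and `massart`
turns this count into the square-root term with `d`; see `ofReal_rademacher_lossOf_le`.

It remains to pass from the sample to the distribution. The supremum of the deviations has bounded
differences, so `mcdiarmid` puts it near its mean, and symmetrization
(`integral_iSup_sub_le_signed`) bounds the mean by twice the Rademacher complexity of the losses.

Only the suprema for the loss class are assumed measurable. The splitting is therefore done
pointwise in the sample, with a choice of hypothesis for each sign vector in place of suprema for
the two parts. -/

/-! ### Contraction for Rademacher averages -/

/-- Flipping the sign of coordinate `i`. -/
def flipSign {m : ℕ} (i : Fin m) (σ : Fin m → ℤˣ) : Fin m → ℤˣ :=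
  Function.update σ i (-σ i)

theorem flipSign_involutive {m : ℕ} (i : Fin m) : Function.Involutive (flipSign i) := by
  intro σ
  simp [flipSign]

/-- Pair each sign vector with its flip at `i`. The two `u`-terms are unaffected by exchanging the
two choices, and the remaining difference of `w`-values is at most the absolute difference of
`v`-values, which is attained by keeping or exchanging the choices. -/
theorem contraction_step {ι : Type*} {m : ℕ} (i : Fin m) (u : (Fin m → ℤˣ) → ι → ℝ)
    (hu : ∀ σ h, u (flipSign i σ) h = u σ h) (v w : ι → ℝ)
    (hvw : ∀ h k, |w h - w k| ≤ |v h - v k|) (g : (Fin m → ℤˣ) → ι) :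
    ∃ g' : (Fin m → ℤˣ) → ι,
      ∑ σ, (u σ (g σ) + ((σ i : ℤ) : ℝ) * w (g σ)) ≤
        ∑ σ, (u σ (g' σ) + ((σ i : ℤ) : ℝ) * v (g' σ)) := by
  classical
  set e : Equiv.Perm (Fin m → ℤˣ) := (flipSign_involutive i).toPerm with he
  let keep : (Fin m → ℤˣ) → Prop := fun σ =>
    0 ≤ ((σ i : ℤ) : ℝ) * (v (g σ) - v (g (flipSign i σ)))
  refine ⟨fun σ => if keep σ then g σ else g (flipSign i σ), ?_⟩
  have hneg : ∀ σ : Fin m → ℤˣ, ((flipSign i σ i : ℤ) : ℝ) = -((σ i : ℤ) : ℝ) := by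
    intro σ; simp [flipSign]
  have hdouble : ∀ f : (Fin m → ℤˣ) → ℝ,
      ∑ σ, f σ = (1 / 2) * ∑ σ, (f σ + f (flipSign i σ)) := by
    intro f
    have : ∑ σ, f (flipSign i σ) = ∑ σ, f σ := Equiv.sum_comp e f
    rw [Finset.sum_add_distrib, this]; ring
  rw [hdouble, hdouble (fun σ => u σ _ + _)]
  refine mul_le_mul_of_nonneg_left (Finset.sum_le_sum fun σ _ => ?_) (by norm_num)
  -- Both members of a pair make the same decision, so the choices are exchanged jointly or not at
  -- all.
  have hkeep : keep (flipSign i σ) ↔ keep σ := by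
    simp only [keep, hneg, flipSign_involutive i σ]
    rw [show -((σ i : ℤ) : ℝ) * (v (g (flipSign i σ)) - v (g σ)) =
      ((σ i : ℤ) : ℝ) * (v (g σ) - v (g (flipSign i σ))) by ring]
  simp only [hkeep, hneg, hu, flipSign_involutive i σ]
  have hlip := hvw (g σ) (g (flipSign i σ))
  rcases Int.units_eq_one_or (σ i) with h1 | h1 <;>
  · by_cases hk : keep σ
    · simp only [hk, if_true]
      simp only [keep, h1] at hk
      push_cast [h1] at hk ⊢
      rcases abs_cases (w (g σ) - w (g (flipSign i σ))) with h | h <;>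
      rcases abs_cases (v (g σ) - v (g (flipSign i σ))) with h' | h' <;> linarith
    · simp only [hk, if_false]
      simp only [keep, h1] at hk
      push_cast [h1] at hk ⊢
      rcases abs_cases (w (g σ) - w (g (flipSign i σ))) with h | h <;>
      rcases abs_cases (v (g σ) - v (g (flipSign i σ))) with h' | h' <;> linarith

/-- **Talagrand's contraction principle**, in terms of selections of near-maximisers. -/
theorem contraction_principle {ι : Type*} {m : ℕ} (v w : ι → Fin m → ℝ)
    (hvw : ∀ h k i, |w h i - w k i| ≤ |v h i - v k i|) (g : (Fin m → ℤˣ) → ι) :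
    ∃ g' : (Fin m → ℤˣ) → ι,
      ∑ σ : Fin m → ℤˣ, ∑ i, ((σ i : ℤ) : ℝ) * w (g σ) i ≤
        ∑ σ : Fin m → ℤˣ, ∑ i, ((σ i : ℤ) : ℝ) * v (g' σ) i := by
  classical
  -- Coordinates in `s` already carry `v`, the others still `w`; they are converted one at a time.
  suffices H : ∀ s : Finset (Fin m), ∃ g' : (Fin m → ℤˣ) → ι,
      ∑ σ : Fin m → ℤˣ, ∑ i, ((σ i : ℤ) : ℝ) * w (g σ) i ≤
        ∑ σ : Fin m → ℤˣ, ∑ i, ((σ i : ℤ) : ℝ) * (if i ∈ s then v (g' σ) i else w (g' σ) i) by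
    simpa using H Finset.univ
  intro s
  induction s using Finset.induction_on with
  | empty => exact ⟨g, by simp⟩
  | insert i s his ih =>
    obtain ⟨g₁, hg₁⟩ := ih
    obtain ⟨g₂, hg₂⟩ := contraction_step i
      (fun σ h => ∑ j ∈ Finset.univ.erase i,
        ((σ j : ℤ) : ℝ) * (if j ∈ s then v h j else w h j))
      (fun σ h => Finset.sum_congr rfl fun j hj => by
        simp [flipSign, Function.update_of_ne (Finset.ne_of_mem_erase hj)])
      (fun h => v h i) (fun h => w h i) (fun h k => hvw h k i) g₁
    refine ⟨g₂, hg₁.trans (le_of_eq_of_le ?_ (hg₂.trans_eq ?_))⟩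
    · refine Finset.sum_congr rfl fun σ _ => ?_
      rw [← Finset.sum_erase_add _ _ (Finset.mem_univ i), if_neg his]
    · refine Finset.sum_congr rfl fun σ _ => ?_
      rw [← Finset.sum_erase_add _ _ (Finset.mem_univ i), if_pos (Finset.mem_insert_self i s)]
      congr 1
      refine Finset.sum_congr rfl fun j hj => ?_
      simp [Finset.mem_insert, Finset.ne_of_mem_erase hj]

/-! ### Massart's lemma -/

/-- This is the optimization over `s` ending a Chernoff-type argument: take `s = E / b`, or `s`
large when `b = 0`. -/
theorem le_sqrt_of_forall_mul_le {E a b : ℝ} (ha : 0 ≤ a) (hb : 0 ≤ b)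
    (h : ∀ s : ℝ, 0 < s → s * E ≤ a + s ^ 2 * b / 2) : E ≤ √(2 * a * b) := by
  by_contra! hE
  have hE0 : 0 < E := (Real.sqrt_nonneg _).trans_lt hE
  have hE2 : 2 * a * b < E ^ 2 := (Real.sqrt_lt' hE0).1 hE
  rcases hb.eq_or_lt with rfl | hb
  · have := h ((a + 1) / E) (by positivity)
    rw [div_mul_cancel₀ _ hE0.ne'] at this
    linarith
  · have := h (E / b) (by positivity)
    have e1 : E / b * E = E ^ 2 / b := by ring
    have e2 : (E / b) ^ 2 * b / 2 = E ^ 2 / b / 2 := by field_simp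
    rw [e1, e2] at this
    have : E ^ 2 / b ≤ 2 * a := by linarith
    rw [div_le_iff₀ hb] at this
    linarith

theorem sum_signs_exp {m : ℕ} (a : Fin m → ℝ) :
    ∑ σ : Fin m → ℤˣ, Real.exp (∑ i, ((σ i : ℤ) : ℝ) * a i) =
      2 ^ m * ∏ i, Real.cosh (a i) := by
  have h : ∀ i, ∑ ε : ℤˣ, Real.exp (((ε : ℤ) : ℝ) * a i) = 2 * Real.cosh (a i) := by
    intro i
    rw [Real.cosh_eq]
    have : (Finset.univ : Finset ℤˣ) = {1, -1} := rfl
    rw [this, Finset.sum_pair (by decide)]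
    push_cast
    ring_nf
  simp_rw [Real.exp_sum]
  rw [← Fintype.prod_sum (fun i (ε : ℤˣ) => Real.exp (((ε : ℤ) : ℝ) * a i))]
  simp_rw [h, Finset.prod_mul_distrib]
  simp

theorem card_signs (m : ℕ) : Fintype.card (Fin m → ℤˣ) = 2 ^ m := by simp

/-- **Massart's finite class lemma**, in terms of selections. -/
theorem massart {m : ℕ} {K : ℝ} (A : Finset (Fin m → ℝ)) (hA : ∀ a ∈ A, ∀ i, |a i| ≤ K)
    (g : (Fin m → ℤˣ) → Fin m → ℝ) (hg : ∀ σ, g σ ∈ A) :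
    ∑ σ : Fin m → ℤˣ, ∑ i, ((σ i : ℤ) : ℝ) * g σ i ≤
      2 ^ m * √(2 * Real.log A.card * (m * K ^ 2)) := by
  have hpos : (0 : ℝ) < 2 ^ m := by positivity
  have hAc : (1 : ℝ) ≤ A.card := by
    exact_mod_cast Finset.card_pos.2 ⟨_, hg 1⟩
  rw [← div_le_iff₀' hpos]
  refine le_sqrt_of_forall_mul_le (Real.log_nonneg hAc) (by positivity) fun s hs => ?_
  -- Jensen moves the exponential inside the average over signs. The chosen vector's exponential is
  -- then at most the sum over all of `A`, and each summand factors into `cosh x ≤ exp (x ^ 2 / 2)`.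
  have hjensen : Real.exp (∑ σ : Fin m → ℤˣ, ((2 : ℝ) ^ m)⁻¹ • (s * ∑ i, ((σ i : ℤ) : ℝ) * g σ i)) ≤
      ∑ σ : Fin m → ℤˣ, ((2 : ℝ) ^ m)⁻¹ • Real.exp (s * ∑ i, ((σ i : ℤ) : ℝ) * g σ i) :=
    convexOn_exp.map_sum_le (fun _ _ => by positivity)
      (by rw [Finset.sum_const, Finset.card_univ, card_signs]; simp) (fun _ _ => Set.mem_univ _)
  have hlhs : ∑ σ : Fin m → ℤˣ, ((2 : ℝ) ^ m)⁻¹ • (s * ∑ i, ((σ i : ℤ) : ℝ) * g σ i) =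
      s * ((∑ σ : Fin m → ℤˣ, ∑ i, ((σ i : ℤ) : ℝ) * g σ i) / 2 ^ m) := by
    simp_rw [smul_eq_mul, ← Finset.mul_sum]; ring
  have hone : ∀ a ∈ A, ∑ σ : Fin m → ℤˣ, Real.exp (s * ∑ i, ((σ i : ℤ) : ℝ) * a i) ≤
      2 ^ m * Real.exp (s ^ 2 * (m * K ^ 2) / 2) := by
    intro a ha
    have : ∀ σ : Fin m → ℤˣ, s * ∑ i, ((σ i : ℤ) : ℝ) * a i =
        ∑ i, ((σ i : ℤ) : ℝ) * (s * a i) := by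
      intro σ; rw [Finset.mul_sum]; exact Finset.sum_congr rfl fun i _ => by ring
    simp_rw [this]
    rw [sum_signs_exp]
    refine mul_le_mul_of_nonneg_left ?_ hpos.le
    calc ∏ i, Real.cosh (s * a i) ≤ ∏ _i : Fin m, Real.exp (s ^ 2 * K ^ 2 / 2) := by
          refine Finset.prod_le_prod (fun i _ => (Real.cosh_pos _).le) fun i _ => ?_
          refine (Real.cosh_le_exp_half_sq _).trans (Real.exp_le_exp.2 ?_)
          have : a i ^ 2 ≤ K ^ 2 := sq_le_sq' (neg_le_of_abs_le (hA a ha i)) (le_of_abs_le (hA a ha i))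
          rw [mul_pow]
          gcongr
      _ = Real.exp (s ^ 2 * (m * K ^ 2) / 2) := by
          rw [Finset.prod_const, ← Real.exp_nat_mul]
          simp only [Finset.card_univ, Fintype.card_fin]
          congr 1; ring
  have hrhs : ∑ σ : Fin m → ℤˣ, ((2 : ℝ) ^ m)⁻¹ • Real.exp (s * ∑ i, ((σ i : ℤ) : ℝ) * g σ i) ≤
      A.card * Real.exp (s ^ 2 * (m * K ^ 2) / 2) := by
    simp_rw [smul_eq_mul, ← Finset.mul_sum]
    rw [inv_mul_le_iff₀ hpos]
    calc ∑ σ : Fin m → ℤˣ, Real.exp (s * ∑ i, ((σ i : ℤ) : ℝ) * g σ i)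
        ≤ ∑ σ : Fin m → ℤˣ, ∑ a ∈ A, Real.exp (s * ∑ i, ((σ i : ℤ) : ℝ) * a i) :=
          Finset.sum_le_sum fun σ _ => Finset.single_le_sum
            (f := fun a => Real.exp (s * ∑ i, ((σ i : ℤ) : ℝ) * a i))
            (fun _ _ => (Real.exp_pos _).le) (hg σ)
      _ = ∑ a ∈ A, ∑ σ : Fin m → ℤˣ, Real.exp (s * ∑ i, ((σ i : ℤ) : ℝ) * a i) :=
          Finset.sum_comm
      _ ≤ ∑ _a ∈ A, 2 ^ m * Real.exp (s ^ 2 * (m * K ^ 2) / 2) := Finset.sum_le_sum hone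
      _ = _ := by rw [Finset.sum_const, nsmul_eq_mul]; ring
  rw [hlhs] at hjensen
  have := hjensen.trans hrhs
  rwa [← Real.exp_log (by linarith : (0 : ℝ) < A.card), ← Real.exp_add, Real.exp_le_exp] at this

/-! ### Sauer's lemma and the growth function -/

/-- Since `d / m ≤ 1`, weighting by `(d / m) ^ d` is dominated by weighting the `k`-th term by `(d /
m) ^ k`; the full binomial sum is `(1 + d / m) ^ m ≤ exp d`. -/
theorem sum_choose_le_pow {d m : ℕ} (hd : 0 < d) (hdm : d ≤ m) :
    ((∑ k ∈ Finset.Iic d, m.choose k : ℕ) : ℝ) ≤ (Real.exp 1 * m / d) ^ d := by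
  have hd' : (0 : ℝ) < d := by exact_mod_cast hd
  have hm' : (0 : ℝ) < m := by exact_mod_cast hd.trans_le hdm
  have hq1 : (d : ℝ) / m ≤ 1 := by
    rw [div_le_one hm']; exact_mod_cast hdm
  have hq0 : (0 : ℝ) < (d : ℝ) / m := by positivity
  have key : ((∑ k ∈ Finset.Iic d, m.choose k : ℕ) : ℝ) * ((d : ℝ) / m) ^ d ≤ Real.exp 1 ^ d := by
    calc ((∑ k ∈ Finset.Iic d, m.choose k : ℕ) : ℝ) * ((d : ℝ) / m) ^ d
        = ∑ k ∈ Finset.Iic d, (m.choose k : ℝ) * ((d : ℝ) / m) ^ d := by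
          rw [Nat.cast_sum, Finset.sum_mul]
      _ ≤ ∑ k ∈ Finset.Iic d, (m.choose k : ℝ) * ((d : ℝ) / m) ^ k := by
          refine Finset.sum_le_sum fun k hk => mul_le_mul_of_nonneg_left ?_ (by positivity)
          exact pow_le_pow_of_le_one hq0.le hq1 (Finset.mem_Iic.1 hk)
      _ ≤ ∑ k ∈ Finset.range (m + 1), (m.choose k : ℝ) * ((d : ℝ) / m) ^ k := by
          refine Finset.sum_le_sum_of_subset_of_nonneg ?_ fun _ _ _ => by positivity
          intro k hk
          have := Finset.mem_Iic.1 hk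
          exact Finset.mem_range.2 (by omega)
      _ = ((d : ℝ) / m + 1) ^ m := by
          rw [add_pow]
          exact Finset.sum_congr rfl fun k _ => by rw [one_pow]; ring
      _ ≤ Real.exp ((d : ℝ) / m) ^ m :=
          pow_le_pow_left₀ (by positivity) (Real.add_one_le_exp _) _
      _ = Real.exp 1 ^ d := by
          rw [← Real.exp_nat_mul, ← Real.exp_nat_mul]
          congr 1; field_simp
  have : (Real.exp 1 * m / d) ^ d = Real.exp 1 ^ d / ((d : ℝ) / m) ^ d := by
    rw [← div_pow]; congr 1; field_simp
  rw [this, le_div_iff₀ (by positivity)]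
  exact key

theorem log_sum_choose_le {d m : ℕ} (hdm : d ≤ m) :
    Real.log ((∑ k ∈ Finset.Iic d, m.choose k : ℕ) : ℝ) ≤ d * Real.log (Real.exp 1 * m / d) := by
  rcases Nat.eq_zero_or_pos d with rfl | hd
  · simp [show Finset.Iic 0 = ({0} : Finset ℕ) from rfl]
  · rw [← Real.log_pow]
    refine Real.log_le_log ?_ (sum_choose_le_pow hd hdm)
    have : 0 < ∑ k ∈ Finset.Iic d, m.choose k :=
      Finset.sum_pos (fun k hk => Nat.choose_pos ((Finset.mem_Iic.1 hk).trans hdm)) ⟨0, by simp⟩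
    exact_mod_cast this

/-- **Sauer's lemma** for the patterns which a family of sets picks out of a list of points. -/
theorem card_patterns_le {α : Type*} {C : Set (Set α)} {d m : ℕ} (hC : vcDimension C ≤ d)
    (p : Fin m → α) (P : Finset (Finset (Fin m)))
    (hP : ∀ s ∈ P, ∃ c ∈ C, ∀ i, i ∈ s ↔ p i ∈ c) :
    P.card ≤ ∑ k ∈ Finset.Iic d, m.choose k := by
  classical
  have hvc : P.vcDim ≤ d := by
    refine Finset.sup_le fun s hs => ?_
    rw [Finset.mem_shatterer] at hs
    -- The points may repeat, but a shattered index set contains no repetition: a pattern isolating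
    -- `i` would also contain any `j` with the same point.
    have hinj : Set.InjOn p s := by
      intro i hi j hj hij
      by_contra hne
      obtain ⟨u, hu, hsu⟩ := hs (Finset.singleton_subset_iff.2 hi)
      obtain ⟨c, -, hc⟩ := hP u hu
      have h1 : i ∈ u := (Finset.mem_inter.1 (hsu ▸ Finset.mem_singleton_self i)).2
      have h2 : j ∈ u := by rw [hc, ← hij, ← hc]; exact h1
      have : j ∈ s ∩ u := Finset.mem_inter.2 ⟨hj, h2⟩
      rw [hsu, Finset.mem_singleton] at this
      exact hne this.symm
    have hsh : ShattersFinset C (s.image p) := by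
      intro T hT
      obtain ⟨u, hu, hsu⟩ := hs (Finset.filter_subset (fun i => p i ∈ T) s)
      obtain ⟨c, hcC, hc⟩ := hP u hu
      refine ⟨c, hcC, fun a ha => ?_⟩
      obtain ⟨i, hi, rfl⟩ := Finset.mem_image.1 ha
      rw [← hc]
      have : i ∈ s ∩ u ↔ i ∈ s.filter (fun i => p i ∈ T) := by rw [hsu]
      simpa [hi] using this
    have hle : ((s.image p).card : ℕ∞) ≤ vcDimension C :=
      le_iSup₂_of_le (f := fun (A : Finset α) (_ : ShattersFinset C A) => (A.card : ℕ∞))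
        (s.image p) hsh le_rfl
    rw [Finset.card_image_of_injOn hinj] at hle
    exact_mod_cast hle.trans hC
  calc P.card ≤ P.shatterer.card := P.card_le_card_shatterer
    _ ≤ ∑ k ∈ Finset.Iic P.vcDim, (Fintype.card (Fin m)).choose k :=
        Finset.card_shatterer_le_sum_vcDim
    _ ≤ ∑ k ∈ Finset.Iic d, m.choose k := by
        rw [Fintype.card_fin]
        exact Finset.sum_le_sum_of_subset (Finset.Iic_subset_Iic.2 hvc)

/-! ### Bounded differences -/

theorem integrable_of_abs_le {Ω : Type*} [MeasurableSpace Ω] {μ : Measure Ω} [IsFiniteMeasure μ]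
    {f : Ω → ℝ} {K : ℝ} (hf : AEMeasurable f μ) (hK : ∀ ω, |f ω| ≤ K) : Integrable f μ :=
  Integrable.of_bound hf.aestronglyMeasurable K (Filter.Eventually.of_forall hK)

theorem bddAbove_range_of_abs_le {ι : Type*} {f : ι → ℝ} {K : ℝ} (h : ∀ i, |f i| ≤ K) :
    BddAbove (Set.range f) :=
  ⟨K, by rintro _ ⟨i, rfl⟩; exact le_of_abs_le (h i)⟩

theorem abs_ciSup_le {ι : Type*} [Nonempty ι] {f : ι → ℝ} {K : ℝ} (h : ∀ i, |f i| ≤ K) :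
    |⨆ i, f i| ≤ K := by
  refine abs_le.2 ⟨?_, ciSup_le fun i => le_of_abs_le (h i)⟩
  obtain ⟨i⟩ := ‹Nonempty ι›
  exact (neg_le_of_abs_le (h i)).trans (le_ciSup (bddAbove_range_of_abs_le h) i)

theorem abs_sum_signs_le {m : ℕ} {K : ℝ} (σ : Fin m → ℤˣ) {a : Fin m → ℝ} (h : ∀ i, |a i| ≤ K) :
    |∑ i, ((σ i : ℤ) : ℝ) * a i| ≤ m * K := by
  refine (Finset.abs_sum_le_sum_abs _ _).trans ?_
  refine (Finset.sum_le_sum fun i _ => ?_).trans_eq (b := ∑ _i : Fin m, K) (by simp)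
  have : |((σ i : ℤ) : ℝ)| = 1 := by
    rcases Int.units_eq_one_or (σ i) with h | h <;> simp [h]
  rw [abs_mul, this, one_mul]
  exact h i

theorem abs_mul_integral_sub_sum_le {Z : Type*} [MeasurableSpace Z] (μ : Measure Z)
    [IsProbabilityMeasure μ] {m : ℕ} {K : ℝ} {f : Z → ℝ} (hK : ∀ z, |f z| ≤ K) (S : Fin m → Z) :
    |m * ∫ z, f z ∂μ - ∑ i, f (S i)| ≤ m * K + m * K := by
  have hint : |∫ z, f z ∂μ| ≤ K := by
    simpa using norm_integral_le_of_norm_le_const (μ := μ) (f := f) (C := K)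
      (Filter.Eventually.of_forall hK)
  refine (abs_sub _ _).trans (add_le_add ?_ ?_)
  · rw [abs_mul, Nat.abs_cast]
    exact mul_le_mul_of_nonneg_left hint (Nat.cast_nonneg m)
  · simpa using abs_sum_signs_le 1 (fun i => hK (S i))

/-- The moment generating function bound behind **McDiarmid's inequality**. -/
theorem integral_exp_le_of_boundedDifferences {Z : Type*} [MeasurableSpace Z] (μ : Measure Z)
    [IsProbabilityMeasure μ] {c K : ℝ} (hc : 0 ≤ c) (m : ℕ) :
    ∀ f : (Fin m → Z) → ℝ, AEMeasurable f (Measure.pi fun _ => μ) → (∀ S, |f S| ≤ K) →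
      (∀ S i z, |f (Function.update S i z) - f S| ≤ c) → ∀ s : ℝ,
      ∫ S, Real.exp (s * f S) ∂(Measure.pi fun _ => μ) ≤
        Real.exp (s * ∫ S, f S ∂(Measure.pi fun _ => μ) + m * (c / 2) ^ 2 * s ^ 2 / 2) := by
  induction m with
  | zero =>
    intro f _ _ _ s
    have h : ∀ S, f S = f default := fun S => congrArg f (Subsingleton.elim _ _)
    simp_rw [h]
    simp
  | succ m ih =>
    intro f hf hK hbd s
    set ν : Measure (Fin m → Z) := Measure.pi fun _ => μ with hν
    have hmp := (measurePreserving_piFinSuccAbove (fun _ : Fin (m + 1) => μ) 0).symm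
    set e := (MeasurableEquiv.piFinSuccAbove (fun _ : Fin (m + 1) => Z) 0).symm with he
    have hecons : ∀ p : Z × (Fin m → Z), e p = Fin.cons p.1 p.2 := by
      intro p; simp [he, MeasurableEquiv.piFinSuccAbove, Fin.insertNthEquiv]
    have hf' : AEMeasurable (fun p => f (e p)) (μ.prod ν) := hf.comp_quasiMeasurePreserving hmp.quasiMeasurePreserving
    rw [← hmp.integral_comp' (fun S => Real.exp (s * f S)), ← hmp.integral_comp' f]
    have hexpb : ∀ S, |Real.exp (s * f S)| ≤ Real.exp (|s| * K) := by
      intro S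
      rw [abs_of_pos (Real.exp_pos _), Real.exp_le_exp]
      calc s * f S ≤ |s * f S| := le_abs_self _
        _ = |s| * |f S| := abs_mul _ _
        _ ≤ |s| * K := mul_le_mul_of_nonneg_left (hK S) (abs_nonneg s)
    have hfi : Integrable (fun p => f (e p)) (μ.prod ν) := integrable_of_abs_le hf' fun p => hK _
    have hei : Integrable (fun p => Real.exp (s * f (e p))) (μ.prod ν) :=
      integrable_of_abs_le (hf'.const_mul s).exp fun p => hexpb _
    change ∫ p, Real.exp (s * f (e p)) ∂(μ.prod ν) ≤
      Real.exp (s * ∫ p, f (e p) ∂(μ.prod ν) + _)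
    rw [integral_prod _ hei, integral_prod _ hfi]
    -- Condition on the first coordinate: the induction hypothesis handles the sections, Hoeffding's
    -- lemma the conditional mean `G`.
    set G : Z → ℝ := fun z => ∫ y, f (e (z, y)) ∂ν with hG
    have hGm : AEMeasurable G μ := hfi.aestronglyMeasurable.integral_prod_right'.aemeasurable
    have hsec : ∀ᵐ z ∂μ, AEMeasurable (fun y => f (e (z, y))) ν := by
      filter_upwards [hfi.aestronglyMeasurable.prodMk_left] with z hz using hz.aemeasurable
    have hGK : ∀ z, |G z| ≤ K := by
      intro z
      have := norm_integral_le_of_norm_le_const (μ := ν) (f := fun y => f (e (z, y))) (C := K)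
        (Filter.Eventually.of_forall fun y => hK _)
      simpa using this
    have hinner : ∀ᵐ z ∂μ, ∫ y, Real.exp (s * f (e (z, y))) ∂ν ≤
        Real.exp (s * G z + m * (c / 2) ^ 2 * s ^ 2 / 2) := by
      filter_upwards [hsec] with z hz
      refine ih (fun y => f (e (z, y))) hz (fun y => hK _) (fun y i x => ?_) s
      have : e (z, Function.update y i x) = Function.update (e (z, y)) i.succ x := by
        rw [hecons, hecons, Fin.cons_update]
      rw [this]
      exact hbd _ _ _
    have hosc : ∀ z z', AEMeasurable (fun y => f (e (z, y))) ν →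
        AEMeasurable (fun y => f (e (z', y))) ν → G z ≤ G z' + c := by
      intro z z' hz hz'
      have h1 : G z ≤ ∫ y, (f (e (z', y)) + c) ∂ν := by
        refine integral_mono (integrable_of_abs_le hz fun _ => hK _)
          ((integrable_of_abs_le hz' fun _ => hK _).add (integrable_const c)) fun y => ?_
        have := hbd (e (z', y)) 0 z
        have hu : Function.update (e (z', y)) 0 z = e (z, y) := by
          rw [hecons, hecons, Fin.update_cons_zero]
        rw [hu] at this
        have := le_of_abs_le this
        simp only
        linarith
      rw [integral_add (integrable_of_abs_le hz' fun _ => hK _) (integrable_const c)] at h1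
      simpa using h1
    -- `f` is only a.e. measurable, so the oscillation bound on `G` holds only between points with
    -- measurable sections; the infimum is restricted to these.
    set N : Set Z := {z | AEMeasurable (fun y => f (e (z, y))) ν} with hN
    have hbdd : BddBelow (G '' N) := by
      refine ⟨-K, ?_⟩
      rintro _ ⟨z, -, rfl⟩
      exact neg_le_of_abs_le (hGK z)
    set a := sInf (G '' N) with ha
    have hIcc : ∀ᵐ z ∂μ, G z ∈ Set.Icc a (a + c) := by
      filter_upwards [hsec] with z hz
      refine ⟨csInf_le hbdd ⟨z, hz, rfl⟩, ?_⟩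
      have : G z - c ≤ a := by
        refine le_csInf ⟨_, z, hz, rfl⟩ ?_
        rintro _ ⟨z', hz', rfl⟩
        linarith [hosc z z' hz hz']
      linarith
    have hhoef := (ProbabilityTheory.hasSubgaussianMGF_of_mem_Icc hGm hIcc).mgf_le s
    have hcoe : ((((‖a + c - a‖₊ / 2) ^ 2 : NNReal)) : ℝ) = (c / 2) ^ 2 := by
      simp [abs_of_nonneg hc]
    rw [hcoe] at hhoef
    have hGe : ∀ C : ℝ, Integrable (fun z => Real.exp (s * G z + C)) μ := by
      intro C
      refine integrable_of_abs_le (K := Real.exp (|s| * K + C))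
        ((hGm.const_mul s).add_const C).exp fun z => ?_
      rw [abs_of_pos (Real.exp_pos _), Real.exp_le_exp]
      have : s * G z ≤ |s| * K := calc
        s * G z ≤ |s * G z| := le_abs_self _
        _ = |s| * |G z| := abs_mul _ _
        _ ≤ |s| * K := mul_le_mul_of_nonneg_left (hGK z) (abs_nonneg s)
      linarith
    calc ∫ z, ∫ y, Real.exp (s * f (e (z, y))) ∂ν ∂μ
        ≤ ∫ z, Real.exp (s * G z + m * (c / 2) ^ 2 * s ^ 2 / 2) ∂μ :=
          integral_mono_ae hei.integral_prod_left (hGe _) hinner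
      _ = Real.exp (s * ∫ z, G z ∂μ + m * (c / 2) ^ 2 * s ^ 2 / 2) *
            ProbabilityTheory.mgf (fun z => G z - ∫ z, G z ∂μ) μ s := by
          rw [ProbabilityTheory.mgf, ← integral_const_mul]
          refine integral_congr_ae (Filter.Eventually.of_forall fun z => ?_)
          simp only
          rw [← Real.exp_add]
          congr 1; ring
      _ ≤ Real.exp (s * ∫ z, G z ∂μ + m * (c / 2) ^ 2 * s ^ 2 / 2) *
            Real.exp ((c / 2) ^ 2 * s ^ 2 / 2) :=
          mul_le_mul_of_nonneg_left hhoef (Real.exp_pos _).le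
      _ = _ := by
          rw [← Real.exp_add]
          congr 1; push_cast; ring

/-- **McDiarmid's inequality.** -/
theorem mcdiarmid {Z : Type*} [MeasurableSpace Z] (μ : Measure Z) [IsProbabilityMeasure μ]
    {c K : ℝ} (hc : 0 ≤ c) {m : ℕ} {f : (Fin m → Z) → ℝ}
    (hf : AEMeasurable f (Measure.pi fun _ => μ)) (hK : ∀ S, |f S| ≤ K)
    (hbd : ∀ S i z, |f (Function.update S i z) - f S| ≤ c) {t : ℝ} (ht : 0 ≤ t) :
    (Measure.pi fun _ => μ).real {S | t ≤ f S - ∫ S, f S ∂(Measure.pi fun _ => μ)} ≤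
      Real.exp (-t ^ 2 / (2 * (m * (c / 2) ^ 2))) := by
  set ν : Measure (Fin m → Z) := Measure.pi fun _ => μ
  have hsub : ProbabilityTheory.HasSubgaussianMGF (fun S => f S - ∫ S, f S ∂ν)
      (⟨m * (c / 2) ^ 2, by positivity⟩ : NNReal) ν := by
    refine ⟨fun s => ?_, fun s => ?_⟩
    · refine integrable_of_abs_le (K := Real.exp (|s| * (K + |∫ S, f S ∂ν|)))
        ((hf.sub_const _).const_mul s).exp fun S => ?_
      rw [abs_of_pos (Real.exp_pos _), Real.exp_le_exp]
      refine (le_abs_self _).trans ?_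
      rw [abs_mul]
      refine mul_le_mul_of_nonneg_left ((abs_sub _ _).trans ?_) (abs_nonneg s)
      linarith [hK S]
    · have h : ∫ S, Real.exp (s * f S) ∂ν ≤
          Real.exp (s * ∫ S, f S ∂ν + m * (c / 2) ^ 2 * s ^ 2 / 2) :=
        integral_exp_le_of_boundedDifferences μ hc m f hf hK hbd s
      rw [ProbabilityTheory.mgf]
      have h2 : ∀ S, Real.exp (s * (f S - ∫ S, f S ∂ν)) =
          Real.exp (-(s * ∫ S, f S ∂ν)) * Real.exp (s * f S) := by
        intro S; rw [← Real.exp_add]; congr 1; ring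
      simp_rw [h2]
      rw [integral_const_mul]
      refine (mul_le_mul_of_nonneg_left h (Real.exp_pos _).le).trans_eq ?_
      rw [← Real.exp_add]
      congr 1
      change _ = (m * (c / 2) ^ 2 : ℝ) * s ^ 2 / 2
      ring
  exact hsub.measure_ge_le ht

/-! ### Symmetrization -/

theorem measurePreserving_eval_pi {Z : Type*} [MeasurableSpace Z] (μ : Measure Z)
    [IsProbabilityMeasure μ] {m : ℕ} (i : Fin m) :
    MeasurePreserving (Function.eval i) (Measure.pi fun _ : Fin m => μ) μ :=
  measurePreserving_eval (fun _ => μ) i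

/-- Two independent samples form one sample of i.i.d. pairs, and exchanging the entries of selected
pairs preserves the product law. -/
theorem measurePreserving_swap_signs {Z : Type*} [MeasurableSpace Z] (μ : Measure Z)
    [IsProbabilityMeasure μ] {m : ℕ} (σ : Fin m → ℤˣ) :
    MeasurePreserving
      (fun p : (Fin m → Z) × (Fin m → Z) =>
        ((fun i => if σ i = 1 then p.2 i else p.1 i, fun i => if σ i = 1 then p.1 i else p.2 i) :
          (Fin m → Z) × (Fin m → Z)))
      ((Measure.pi fun _ => μ).prod (Measure.pi fun _ => μ))
      ((Measure.pi fun _ => μ).prod (Measure.pi fun _ => μ)) := by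
  have h1 := measurePreserving_arrowProdEquivProdArrow Z Z (Fin m) (fun _ => μ) (fun _ => μ)
  have h2 : MeasurePreserving
      (fun (a : Fin m → Z × Z) i => (if σ i = 1 then Prod.swap else id) (a i))
      (Measure.pi fun _ => μ.prod μ) (Measure.pi fun _ => μ.prod μ) :=
    measurePreserving_pi _ _ fun i => by
      split_ifs
      · exact Measure.measurePreserving_swap
      · exact MeasurePreserving.id _
  convert! h1.comp (h2.comp h1.symm) using 1
  funext p
  simp only [Function.comp, MeasurableEquiv.arrowProdEquivProdArrow, Equiv.arrowProdEquivProdArrow]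
  ext i <;> by_cases h : σ i = 1 <;> simp [h]

/-- **Symmetrization** for a fixed sign vector; measurability is needed only of the suprema in
the statement. -/
theorem integral_iSup_sub_le_signed {Z ι : Type*} [MeasurableSpace Z] [Nonempty ι] (μ : Measure Z)
    [IsProbabilityMeasure μ] {m : ℕ} {K : ℝ} (l : ι → Z → ℝ) (hl : ∀ h, Measurable (l h))
    (hK : ∀ h z, |l h z| ≤ K)
    (hU : ∀ σ : Fin m → ℤˣ, AEMeasurable (fun S : Fin m → Z => ⨆ h, ∑ i, ((σ i : ℤ) : ℝ) * l h (S i))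
      (Measure.pi fun _ => μ))
    (hF : AEMeasurable (fun S : Fin m → Z => ⨆ h, (m * ∫ z, l h z ∂μ - ∑ i, l h (S i)))
      (Measure.pi fun _ => μ)) (σ : Fin m → ℤˣ) :
    ∫ S, (⨆ h, (m * ∫ z, l h z ∂μ - ∑ i, l h (S i))) ∂(Measure.pi fun _ : Fin m => μ) ≤
      ∫ S, (⨆ h, ∑ i, ((σ i : ℤ) : ℝ) * l h (S i)) ∂(Measure.pi fun _ : Fin m => μ) +
      ∫ S, (⨆ h, ∑ i, (((-σ) i : ℤ) : ℝ) * l h (S i)) ∂(Measure.pi fun _ : Fin m => μ) := by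
  set ν : Measure (Fin m → Z) := Measure.pi fun _ => μ with hν
  set U : (Fin m → ℤˣ) → (Fin m → Z) → ℝ :=
    fun σ S => ⨆ h, ∑ i, ((σ i : ℤ) : ℝ) * l h (S i) with hUdef
  have hsum : ∀ (σ : Fin m → ℤˣ) (S : Fin m → Z) h, |∑ i, ((σ i : ℤ) : ℝ) * l h (S i)| ≤ m * K :=
    fun σ S h => abs_sum_signs_le σ fun i => hK h (S i)
  have hUle : ∀ σ S h, ∑ i, ((σ i : ℤ) : ℝ) * l h (S i) ≤ U σ S := fun σ S h =>
    le_ciSup (bddAbove_range_of_abs_le (hsum σ S)) h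
  have hUi : ∀ σ, Integrable (U σ) ν := fun σ =>
    integrable_of_abs_le (hU σ) fun S => abs_ciSup_le (hsum σ S)
  have hFi : Integrable (fun S : Fin m → Z => ⨆ h, (m * ∫ z, l h z ∂μ - ∑ i, l h (S i))) ν :=
    integrable_of_abs_le hF fun S => abs_ciSup_le fun h =>
      abs_mul_integral_sub_sum_le μ (hK h) S
  have hswap := measurePreserving_swap_signs μ σ
  rw [← hν] at hswap
  set T : (Fin m → Z) × (Fin m → Z) → (Fin m → Z) × (Fin m → Z) := fun p =>
    (fun i => if σ i = 1 then p.2 i else p.1 i, fun i => if σ i = 1 then p.1 i else p.2 i) with hT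
  have hV : Integrable (fun p : (Fin m → Z) × (Fin m → Z) => U σ p.1 + U (-σ) p.2) (ν.prod ν) :=
    ((hUi σ).comp_fst ν).add ((hUi (-σ)).comp_snd ν)
  have hVT : Integrable (fun p => U σ (T p).1 + U (-σ) (T p).2) (ν.prod ν) :=
    hswap.integrable_comp_of_integrable hV
  have hVint : ∫ S, U σ S ∂ν + ∫ S, U (-σ) S ∂ν =
      ∫ W, ∫ W', (U σ (T (W, W')).1 + U (-σ) (T (W, W')).2) ∂ν ∂ν := by
    rw [← integral_prod _ hVT]
    have h1 : ∫ p, (U σ (T p).1 + U (-σ) (T p).2) ∂(ν.prod ν) =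
        ∫ p : (Fin m → Z) × (Fin m → Z), (U σ p.1 + U (-σ) p.2) ∂(ν.prod ν) := by
      conv_rhs => rw [← hswap.map_eq]
      rw [integral_map hswap.measurable.aemeasurable]
      rw [hswap.map_eq]
      exact hV.aestronglyMeasurable
    rw [h1, integral_add ((hUi σ).comp_fst ν) ((hUi (-σ)).comp_snd ν), integral_fun_fst, integral_fun_snd]
    simp
  change _ ≤ ∫ S, U σ S ∂ν + ∫ S, U (-σ) S ∂ν
  rw [hVint]
  refine integral_mono_ae hFi hVT.integral_prod_left ?_
  filter_upwards [hVT.prod_right_ae] with W hW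
  refine ciSup_le fun h => ?_
  have hev : ∀ i : Fin m, Integrable (fun W' : Fin m → Z => l h (W' i)) ν := fun i =>
    integrable_of_abs_le ((hl h).comp (measurable_pi_apply i)).aemeasurable fun _ => hK _ _
  have hevi : ∀ i : Fin m, ∫ W' : Fin m → Z, l h (W' i) ∂ν = ∫ z, l h z ∂μ := by
    intro i
    have hmp := measurePreserving_eval_pi μ i
    conv_rhs => rw [← hmp.map_eq]
    rw [integral_map hmp.measurable.aemeasurable]
    · exact (hl h).aestronglyMeasurable
  -- The second sample `W'` replaces the expectation. After the swap `T`, each difference `l h (W'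
  -- i) - l h (W i)` is a `σ`-signed term of the first sample plus a `-σ`-signed term of the second.
  calc m * ∫ z, l h z ∂μ - ∑ i, l h (W i)
      = ∫ W' : Fin m → Z, (∑ i, l h (W' i) - ∑ i, l h (W i)) ∂ν := by
        rw [integral_sub (integrable_finsetSum _ fun i _ => hev i) (integrable_const _),
          integral_finsetSum _ fun i _ => hev i]
        simp_rw [hevi]
        simp
    _ ≤ ∫ W', (U σ (T (W, W')).1 + U (-σ) (T (W, W')).2) ∂ν := by
        refine integral_mono
          ((integrable_finsetSum _ fun i _ => hev i).sub (integrable_const _)) hW fun W' => ?_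
        refine le_trans (le_of_eq ?_)
          (add_le_add (hUle σ (T (W, W')).1 h) (hUle (-σ) (T (W, W')).2 h))
        simp only
        rw [← Finset.sum_sub_distrib, ← Finset.sum_add_distrib]
        refine Finset.sum_congr rfl fun i _ => ?_
        rcases Int.units_eq_one_or (σ i) with h | h
        · simp [hT, h]; ring
        · simp [hT, h]; ring

/-! ### Suprema and selections -/

/-- Near-maximisers turn a bound for all selections into one for suprema; the `+ 1` in the error
share keeps the denominator positive for empty `κ`. -/
theorem sum_iSup_le {κ ι : Type*} [Fintype κ] [Nonempty ι] (f : κ → ι → ℝ)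
    {K : ℝ} (h : ∀ g : κ → ι, ∑ σ, f σ (g σ) ≤ K) : ∑ σ, ⨆ i, f σ i ≤ K := by
  refine le_of_forall_pos_le_add fun ε hε => ?_
  have hq : (0 : ℝ) < ε / (Fintype.card κ + 1) := by positivity
  have hex : ∀ σ, ∃ i, (⨆ i, f σ i) - ε / (Fintype.card κ + 1) < f σ i := fun σ =>
    exists_lt_of_lt_ciSup (sub_lt_self _ hq)
  choose g hg using hex
  have h1 : ∑ σ, ((⨆ i, f σ i) - ε / (Fintype.card κ + 1)) ≤ K :=
    (Finset.sum_le_sum fun σ _ => (hg σ).le).trans (h g)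
  rw [Finset.sum_sub_distrib, Finset.sum_const, Finset.card_univ, nsmul_eq_mul] at h1
  have h2 : (Fintype.card κ : ℝ) * (ε / (Fintype.card κ + 1)) ≤ ε := by
    rw [mul_div_assoc', div_le_iff₀ (by positivity)]
    nlinarith
  linarith

theorem biSup_image_coe {α β : Type*} (H : Set α) [Nonempty H] (L : α → β) (φ : β → ℝ)
    (hb : BddAbove (Set.range fun h : H => φ (L h))) :
    (⨆ g ∈ L '' H, (φ g : EReal)) = ((⨆ h : H, φ (L h) : ℝ) : EReal) := by
  rw [iSup_image, iSup_subtype']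
  refine le_antisymm (iSup_le fun h => EReal.coe_le_coe_iff.2 (le_ciSup hb h)) ?_
  refine le_of_forall_lt fun c hc => ?_
  induction c with
  | bot =>
    obtain ⟨h⟩ := ‹Nonempty H›
    exact (EReal.bot_lt_coe _).trans_le (le_iSup (fun h : H => (φ (L h) : EReal)) h)
  | coe x =>
    obtain ⟨h, hh⟩ := exists_lt_of_lt_ciSup (EReal.coe_lt_coe_iff.1 hc)
    exact (EReal.coe_lt_coe_iff.2 hh).trans_le (le_iSup (fun h : H => (φ (L h) : EReal)) h)
  | top => exact absurd hc (not_lt.2 le_top)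

/-! ### The auction loss and its Rademacher complexity -/

/-- The Lipschitz part of the auction loss. -/
noncomputable def clippedLoss (r : ℝ) (b : ℝ × ℝ) : ℝ := -max b.2 (min b.1 r)

/-- The part of the auction loss which jumps at the highest bid. -/
noncomputable def jumpLoss (r : ℝ) (b : ℝ × ℝ) : ℝ := if b.1 < r then b.1 else 0

/-- Up to the highest bid the revenue is `max b.2 r`. Beyond it the revenue drops to zero while the
clipped part stays at `-b.1`, and the jump makes up the difference. -/
theorem auctionLoss_eq_add {r : ℝ} {b : ℝ × ℝ} (hb : b.2 ≤ b.1) :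
    auctionLoss r b = clippedLoss r b + jumpLoss r b := by
  unfold auctionLoss auctionRevenue clippedLoss jumpLoss
  by_cases h1 : r < b.2
  · have h2 : ¬ b.1 < r := by linarith
    have h3 : ¬ b.2 ≤ r := by linarith
    rw [min_eq_right (by linarith), max_eq_left h1.le]
    simp [h1, h2, h3]
  · by_cases h2 : b.1 < r
    · have h3 : ¬ r ≤ b.1 := by linarith
      rw [min_eq_left h2.le, max_eq_right hb]
      simp [h1, h2, h3]
    · rw [min_eq_right (by linarith), max_eq_right (by linarith)]
      simp [h1, h2, not_lt.1 h1, not_lt.1 h2]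

theorem abs_clippedLoss_sub_le (r s : ℝ) (b : ℝ × ℝ) :
    |clippedLoss r b - clippedLoss s b| ≤ |r - s| := by
  unfold clippedLoss
  rw [neg_sub_neg, abs_sub_comm]
  calc |max b.2 (min b.1 r) - max b.2 (min b.1 s)| ≤ |min b.1 r - min b.1 s| := by
        simpa using abs_max_sub_max_le_max b.2 (min b.1 r) b.2 (min b.1 s)
    _ ≤ |r - s| := by
        simpa using abs_min_sub_min_le_max b.1 r b.1 s

theorem auctionLoss_mem_Icc {r M : ℝ} {b : ℝ × ℝ} (h0 : 0 ≤ b.2) (hb : b.2 ≤ b.1) (hM : b.1 ≤ M) :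
    auctionLoss r b ∈ Set.Icc (-M) 0 := by
  unfold auctionLoss auctionRevenue
  constructor <;> split_ifs <;> grind

theorem measurable_lossOf {X : Type*} [MeasurableSpace X] {B : Set (ℝ × ℝ)} {h : X → ℝ}
    (hh : Measurable h) : Measurable (lossOf (B := B) h) := by
  have h1 : Measurable fun z : X × B => h z.1 := hh.comp measurable_fst
  have hb : Measurable fun z : X × B => (z.2 : ℝ × ℝ) := measurable_subtype_coe.comp measurable_snd
  have hb1 : Measurable fun z : X × B => (z.2 : ℝ × ℝ).1 := measurable_fst.comp hb
  have hb2 : Measurable fun z : X × B => (z.2 : ℝ × ℝ).2 := measurable_snd.comp hb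
  refine Measurable.neg (Measurable.add ?_ ?_)
  · exact Measurable.ite (measurableSet_lt h1 hb2) hb2 measurable_const
  · exact Measurable.ite ((measurableSet_le hb2 h1).inter (measurableSet_le h1 hb1)) h1
      measurable_const

/-- The contribution of the jumps to the empirical Rademacher complexity. -/
theorem sum_jumpLoss_le {X : Type*} {B : Set (ℝ × ℝ)} {M : ℝ}
    (hB : ∀ b ∈ B, 0 ≤ b.1 ∧ b.1 ≤ M) {H : Set (X → ℝ)} {d m : ℕ}
    (hd : pseudoDimension H ≤ d) (hdm : d ≤ m) (S : Fin m → X × B)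
    (g : (Fin m → ℤˣ) → H) :
    ∑ σ : Fin m → ℤˣ, ∑ i, ((σ i : ℤ) : ℝ) * jumpLoss ((g σ : X → ℝ) (S i).1) (S i).2 ≤
      2 ^ m * √(2 * (d * Real.log (Real.exp 1 * m / d)) * (m * M ^ 2)) := by
  classical
  -- These are the traces of the subgraphs of `H` on the points `(xᵢ, bᵢ.1)`, so the
  -- pseudo-dimension controls their number; each trace determines the jump vector.
  let P : Finset (Finset (Fin m)) := Finset.univ.filter fun s =>
    ∃ h ∈ H, ∀ i, i ∈ s ↔ ((S i).2 : ℝ × ℝ).1 < h (S i).1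
  let A : Finset (Fin m → ℝ) := P.image fun s i => if i ∈ s then ((S i).2 : ℝ × ℝ).1 else 0
  have hPcard : P.card ≤ ∑ k ∈ Finset.Iic d, m.choose k := by
    refine card_patterns_le hd (fun i => ((S i).1, ((S i).2 : ℝ × ℝ).1)) P fun s hs => ?_
    obtain ⟨h, hH, hs⟩ := (Finset.mem_filter.1 hs).2
    exact ⟨_, ⟨h, hH, rfl⟩, fun i => by simp [hs]⟩
  have hmem : ∀ σ, (fun i => jumpLoss ((g σ : X → ℝ) (S i).1) (S i).2) ∈ A := by
    intro σ
    refine Finset.mem_image.2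
      ⟨Finset.univ.filter fun i => ((S i).2 : ℝ × ℝ).1 < (g σ : X → ℝ) (S i).1, ?_, ?_⟩
    · exact Finset.mem_filter.2 ⟨Finset.mem_univ _, g σ, (g σ).2, fun i => by simp⟩
    · funext i
      simp [jumpLoss]
  have hA : ∀ a ∈ A, ∀ i, |a i| ≤ M := by
    intro a ha i
    obtain ⟨s, -, rfl⟩ := Finset.mem_image.1 ha
    have := hB _ (S i).2.2
    dsimp only
    split_ifs
    · rw [abs_of_nonneg this.1]; exact this.2
    · rw [abs_zero]; exact this.1.trans this.2
  refine (massart A hA _ hmem).trans ?_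
  have hApos : 0 < A.card := Finset.card_pos.2 ⟨_, hmem 1⟩
  have hlog : Real.log A.card ≤ d * Real.log (Real.exp 1 * m / d) := by
    refine le_trans (Real.log_le_log (by exact_mod_cast hApos) ?_) (log_sum_choose_le hdm)
    exact_mod_cast Finset.card_image_le.trans hPcard
  gcongr

theorem le_empiricalRademacher {Z : Type*} {m : ℕ} (G : Set (Z → ℝ)) (S : Fin m → Z)
    (g : (Fin m → ℤˣ) → G) :
    (((2 : ℝ) ^ m)⁻¹ * ((1 / (m : ℝ)) * ∑ σ : Fin m → ℤˣ, ∑ i, ((σ i : ℤ) : ℝ) * (g σ : Z → ℝ) (S i)) : ℝ) ≤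
      empiricalRademacher G S := by
  rw [EReal.coe_mul, Finset.mul_sum]
  refine mul_le_mul_of_nonneg_left ?_ (by exact_mod_cast (by positivity : (0 : ℝ) ≤ ((2 : ℝ) ^ m)⁻¹))
  calc ((∑ σ : Fin m → ℤˣ, (1 / (m : ℝ)) * ∑ i, ((σ i : ℤ) : ℝ) * (g σ : Z → ℝ) (S i) : ℝ) : EReal)
      = ∑ σ : Fin m → ℤˣ,
          (((1 / (m : ℝ)) * ∑ i, ((σ i : ℤ) : ℝ) * (g σ : Z → ℝ) (S i) : ℝ) : EReal) :=
        map_sum (⟨⟨((↑) : ℝ → EReal), EReal.coe_zero⟩, EReal.coe_add⟩ : ℝ →+ EReal) _ _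
    _ ≤ ∑ σ : Fin m → ℤˣ, signedSup G S σ :=
        Finset.sum_le_sum fun σ _ => le_iSup₂_of_le (g σ : Z → ℝ) (g σ).2 le_rfl

theorem sqrt_rate {m : ℕ} (hm : 1 ≤ m) {M : ℝ} (hM : 0 ≤ M) (a : ℝ) :
    1 / (m : ℝ) * √(2 * a * (m * M ^ 2)) = M * √(2 * a / m) := by
  have hm' : (0 : ℝ) < m := by exact_mod_cast hm
  rw [show 2 * a * (m * M ^ 2) = (m * M) ^ 2 * (2 * a / m) by field_simp,
    Real.sqrt_mul (by positivity), Real.sqrt_sq (by positivity)]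
  field_simp

/-- The empirical Rademacher complexity of the losses is at most that of the reserve prices plus
the contribution of the jumps. -/
theorem ofReal_rademacher_lossOf_le {X : Type*} {B : Set (ℝ × ℝ)} {M : ℝ}
    (hB : ∀ b ∈ B, 0 ≤ b.2 ∧ b.2 ≤ b.1) (hBM : ∀ b ∈ B, b.1 ≤ M) (hM0 : 0 ≤ M)
    {H : Set (X → ℝ)} [Nonempty H] {d m : ℕ}
    (hd : pseudoDimension H ≤ d) (hm : 1 ≤ m) (hdm : d ≤ m) (S : Fin m → X × B) :
    ENNReal.ofReal (((2 : ℝ) ^ m)⁻¹ * ((1 / (m : ℝ)) *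
        ∑ σ : Fin m → ℤˣ, ⨆ h : H, ∑ i, ((σ i : ℤ) : ℝ) * lossOf (h : X → ℝ) (S i))) ≤
      (empiricalRademacher ((fun (h : X → ℝ) (z : X × B) => h z.1) '' H) S).toENNReal +
        ENNReal.ofReal (M * √(2 * d * Real.log (Real.exp 1 * m / d) / m)) := by
  set R := empiricalRademacher ((fun (h : X → ℝ) (z : X × B) => h z.1) '' H) S with hR
  set C := M * √(2 * d * Real.log (Real.exp 1 * m / d) / m) with hC
  have hm' : (0 : ℝ) < m := by exact_mod_cast hm
  have hC0 : 0 ≤ C := by positivity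
  have hR0 : 0 ≤ R := empiricalRademacher_nonneg (Set.Nonempty.image _ Set.Nonempty.of_subtype) S
  rcases eq_or_ne R ⊤ with hRt | hRt
  · simp [hRt]
  rw [EReal.toENNReal_of_ne_top hRt, ← ENNReal.ofReal_add (EReal.toReal_nonneg hR0) hC0]
  refine ENNReal.ofReal_le_ofReal ?_
  have hRcoe : (R.toReal : EReal) = R :=
    EReal.coe_toReal hRt (ne_of_gt ((EReal.bot_lt_coe 0).trans_le hR0))
  have hscale : ∀ x y : ℝ, ((2 : ℝ) ^ m)⁻¹ * (1 / (m : ℝ) * x) ≤ y ↔ x ≤ 2 ^ m * (m * y) := by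
    intro x y
    rw [inv_mul_le_iff₀ (by positivity), one_div, inv_mul_le_iff₀ hm']
    rw [show (m : ℝ) * (2 ^ m * y) = 2 ^ m * (m * y) by ring]
  rw [hscale]
  -- One selection `g` serves both parts: contraction replaces it by `g'` for the clipped part,
  -- while the jump bound holds for any selection.
  refine sum_iSup_le _ fun g => ?_
  obtain ⟨g', hg'⟩ := contraction_principle (ι := H)
    (fun h i => (h : X → ℝ) (S i).1) (fun h i => clippedLoss ((h : X → ℝ) (S i).1) (S i).2)
    (fun h k i => abs_clippedLoss_sub_le _ _ _) g
  have hjump := sum_jumpLoss_le (M := M) (fun b hb => ⟨(hB b hb).1.trans (hB b hb).2, hBM b hb⟩)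
    hd hdm S g
  have hv : ∑ σ : Fin m → ℤˣ, ∑ i, ((σ i : ℤ) : ℝ) * (g' σ : X → ℝ) (S i).1 ≤
      2 ^ m * (m * R.toReal) := by
    rw [← hscale, ← EReal.coe_le_coe_iff, hRcoe]
    exact le_empiricalRademacher
      ((fun (h : X → ℝ) (z : X × B) => h z.1) '' H) S fun σ => ⟨fun z => (g' σ : X → ℝ) z.1, ⟨(g' σ : X → ℝ), (g' σ).2, rfl⟩⟩
  have hCeq : √(2 * (d * Real.log (Real.exp 1 * m / d)) * (m * M ^ 2)) = m * C := by
    have := sqrt_rate hm hM0 (d * Real.log (Real.exp 1 * m / d))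
    rw [hC, mul_assoc 2 (d : ℝ), ← this]
    field_simp
  rw [hCeq] at hjump
  have hsplit : ∑ σ : Fin m → ℤˣ, ∑ i, ((σ i : ℤ) : ℝ) * lossOf (g σ : X → ℝ) (S i) =
      ∑ σ : Fin m → ℤˣ, ∑ i, ((σ i : ℤ) : ℝ) * clippedLoss ((g σ : X → ℝ) (S i).1) (S i).2 +
      ∑ σ : Fin m → ℤˣ, ∑ i, ((σ i : ℤ) : ℝ) * jumpLoss ((g σ : X → ℝ) (S i).1) (S i).2 := by
    rw [← Finset.sum_add_distrib]
    refine Finset.sum_congr rfl fun σ _ => ?_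
    rw [← Finset.sum_add_distrib]
    refine Finset.sum_congr rfl fun i _ => ?_
    rw [← mul_add, ← auctionLoss_eq_add (hB _ (S i).2.2).2]
    rfl
  rw [hsplit]
  calc _ ≤ 2 ^ m * (m * R.toReal) + 2 ^ m * (m * C) := add_le_add (hg'.trans hv) hjump
    _ = _ := by ring

/-! ### The generalization bound -/

theorem ofReal_integral_le_lintegral {Ω : Type*} [MeasurableSpace Ω] {μ : Measure Ω} {f : Ω → ℝ}
    (hf : Integrable f μ) : ENNReal.ofReal (∫ ω, f ω ∂μ) ≤ ∫⁻ ω, ENNReal.ofReal (f ω) ∂μ := by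
  have h1 : ∫ ω, f ω ∂μ ≤ ∫ ω, max (f ω) 0 ∂μ :=
    integral_mono hf hf.pos_part fun ω => le_max_left _ _
  refine (ENNReal.ofReal_le_ofReal h1).trans ?_
  rw [ofReal_integral_eq_lintegral_ofReal hf.pos_part
    (Filter.Eventually.of_forall fun ω => le_max_right _ _)]
  refine lintegral_mono fun ω => ?_
  simp

/-- The one-sided generalization bound by the expected signed suprema, for losses with values in
an interval of length `M`. -/
theorem generalization_bound {Z ι : Type*} [MeasurableSpace Z] [Nonempty ι] (μ : Measure Z)
    [IsProbabilityMeasure μ] {m : ℕ} (hm : 1 ≤ m) {M : ℝ} (hM : 0 < M) (l : ι → Z → ℝ)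
    (hl : ∀ h, Measurable (l h)) (hlM : ∀ h z, l h z ∈ Set.Icc (-M) 0)
    (hU : ∀ σ : Fin m → ℤˣ, AEMeasurable (fun S : Fin m → Z => ⨆ h, ∑ i, ((σ i : ℤ) : ℝ) * l h (S i))
      (Measure.pi fun _ => μ))
    (hF : AEMeasurable (fun S : Fin m → Z => ⨆ h, (m * ∫ z, l h z ∂μ - ∑ i, l h (S i)))
      (Measure.pi fun _ => μ)) {δ : ℝ} (hδ : 0 < δ) (hδ1 : δ < 1) :
    1 - δ ≤ (Measure.pi fun _ : Fin m => μ).real {S | ∀ h,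
      ∫ z, l h z ∂μ ≤ 1 / (m : ℝ) * ∑ i, l h (S i) +
        2 * ∫ S, ((2 : ℝ) ^ m)⁻¹ * (1 / (m : ℝ) *
          ∑ σ : Fin m → ℤˣ, ⨆ h, ∑ i, ((σ i : ℤ) : ℝ) * l h (S i)) ∂(Measure.pi fun _ => μ) +
        M * √(Real.log (1 / δ) / (2 * m))} := by
  set ν : Measure (Fin m → Z) := Measure.pi fun _ => μ with hν
  have hm' : (0 : ℝ) < m := by exact_mod_cast hm
  have hK : ∀ h z, |l h z| ≤ M := fun h z =>
    abs_le.2 ⟨(hlM h z).1, (hlM h z).2.trans hM.le⟩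
  set U : (Fin m → ℤˣ) → (Fin m → Z) → ℝ :=
    fun σ S => ⨆ h, ∑ i, ((σ i : ℤ) : ℝ) * l h (S i) with hUdef
  set F : (Fin m → Z) → ℝ := fun S => ⨆ h, (m * ∫ z, l h z ∂μ - ∑ i, l h (S i)) with hFdef
  have hUi : ∀ σ, Integrable (U σ) ν := fun σ =>
    integrable_of_abs_le (hU σ) fun S => abs_ciSup_le fun h =>
      abs_sum_signs_le σ fun i => hK h (S i)
  have hFh : ∀ (S : Fin m → Z) h, |m * ∫ z, l h z ∂μ - ∑ i, l h (S i)| ≤ m * M + m * M :=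
    fun S h => abs_mul_integral_sub_sum_le μ (hK h) S
  have hFle : ∀ (S : Fin m → Z) h, m * ∫ z, l h z ∂μ - ∑ i, l h (S i) ≤ F S := fun S h =>
    le_ciSup (bddAbove_range_of_abs_le (hFh S)) h
  have hFbd : ∀ S i z, |F (Function.update S i z) - F S| ≤ M := by
    have key : ∀ (S : Fin m → Z) i z h, |∑ j, l h (Function.update S i z j) - ∑ j, l h (S j)| ≤ M := by
      intro S i z h
      rw [← Finset.sum_sub_distrib, Finset.sum_eq_single i]
      · rw [Function.update_self]
        exact abs_le.2 ⟨by linarith [(hlM h z).1, (hlM h (S i)).2],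
          by linarith [(hlM h z).2, (hlM h (S i)).1]⟩
      · intro j _ hj; simp [Function.update_of_ne hj]
      · simp
    intro S i z
    refine abs_le.2 ⟨?_, ?_⟩
    · have : F S ≤ F (Function.update S i z) + M := ciSup_le fun h => by
        linarith [hFle (Function.update S i z) h, (abs_le.1 (key S i z h)).2]
      linarith
    · have : F (Function.update S i z) ≤ F S + M := ciSup_le fun h => by
        linarith [hFle S h, (abs_le.1 (key S i z h)).1]
      linarith
  set r := ∫ S, ((2 : ℝ) ^ m)⁻¹ * (1 / (m : ℝ) * ∑ σ, U σ S) ∂ν with hr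
  have hEF : ∫ S, F S ∂ν ≤ 2 * (m * r) := by
    -- Averaging over `σ`, the terms for `σ` and `-σ` contribute equally; this is the factor 2.
    have h1 : ∀ σ : Fin m → ℤˣ, ∫ S, F S ∂ν ≤ ∫ S, U σ S ∂ν + ∫ S, U (-σ) S ∂ν :=
      integral_iSup_sub_le_signed μ l hl hK hU hF
    have h2 : ∑ _σ : Fin m → ℤˣ, ∫ S, F S ∂ν ≤
        ∑ σ, (∫ S, U σ S ∂ν + ∫ S, U (-σ) S ∂ν) := Finset.sum_le_sum fun σ _ => h1 σ
    have h3 : ∑ σ : Fin m → ℤˣ, ∫ S, U (-σ) S ∂ν = ∑ σ, ∫ S, U σ S ∂ν :=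
      Equiv.sum_comp (Equiv.neg (Fin m → ℤˣ)) (fun σ => ∫ S, U σ S ∂ν)
    rw [Finset.sum_add_distrib, h3, Finset.sum_const, Finset.card_univ, card_signs,
      nsmul_eq_mul] at h2
    have h4 : r = ((2 : ℝ) ^ m)⁻¹ * (1 / (m : ℝ) * ∑ σ, ∫ S, U σ S ∂ν) := by
      rw [hr, integral_const_mul, integral_const_mul, integral_finsetSum _ fun σ _ => hUi σ]
    have h5 : 2 ^ m * (2 * (m * r)) = ∑ σ, ∫ S, U σ S ∂ν + ∑ σ, ∫ S, U σ S ∂ν := by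
      rw [h4]; field_simp; ring
    rw [← h5] at h2
    push_cast at h2
    exact le_of_mul_le_mul_left h2 (by positivity)
  have hlog : 0 < Real.log (1 / δ) := Real.log_pos (one_lt_one_div hδ hδ1)
  set t := M * √(Real.log (1 / δ) / (2 * m)) with ht
  -- `F` is not divided by `m`, hence difference bound `M` and threshold `m * t`.
  have hmc := mcdiarmid μ hM.le hF (fun S => abs_ciSup_le (hFh S)) hFbd
    (t := m * t) (by positivity)
  have hexp : Real.exp (-(m * t) ^ 2 / (2 * (m * (M / 2) ^ 2))) = δ := by
    have : -(m * t) ^ 2 / (2 * (m * (M / 2) ^ 2)) = -Real.log (1 / δ) := by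
      rw [ht, mul_pow, mul_pow, Real.sq_sqrt (by positivity)]
      field_simp
    rw [this, one_div, Real.log_inv, neg_neg, Real.exp_log hδ]
  rw [hexp] at hmc
  change ν.real {S | m * t ≤ F S - ∫ S, F S ∂ν} ≤ δ at hmc
  have hcompl : 1 ≤ ν.real {S | m * t ≤ F S - ∫ S, F S ∂ν} +
      ν.real {S | m * t ≤ F S - ∫ S, F S ∂ν}ᶜ := by
    have := measureReal_union_le (μ := ν) {S | m * t ≤ F S - ∫ S, F S ∂ν}
      {S | m * t ≤ F S - ∫ S, F S ∂ν}ᶜ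
    rwa [Set.union_compl_self, probReal_univ] at this
  refine le_trans (by linarith) (measureReal_mono (fun S hS h => ?_)
    (s₁ := {S | m * t ≤ F S - ∫ S, F S ∂ν}ᶜ))
  have hS' : F S - ∫ S, F S ∂ν < m * t := not_le.1 hS
  have h1 := hFle S h
  have h2 : m * ∫ z, l h z ∂μ ≤ m * (1 / (m : ℝ) * ∑ i, l h (S i) + 2 * r + t) := by
    have : (m : ℝ) * (1 / (m : ℝ) * ∑ i, l h (S i)) = ∑ i, l h (S i) := by field_simp
    rw [mul_add, mul_add, this]
    linarith
  exact le_of_mul_le_mul_left h2 hm'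

theorem mainTheorem2 {X : Type*} [MeasurableSpace X]
    (B : Set (ℝ × ℝ)) (hB : ∀ b ∈ B, 0 ≤ b.2 ∧ b.2 ≤ b.1)
    (hBdd : BddAbove (Prod.fst '' B))
    (M : ℝ) (hM : M = sSup (Prod.fst '' B))
    (D : MeasureTheory.Measure (X × B)) [MeasureTheory.IsProbabilityMeasure D]
    (H : Set (X → ℝ)) (hH : ∀ h ∈ H, Measurable h)
    (d : ℕ) (hd : pseudoDimension H = d)
    (m : ℕ) (hm : 1 ≤ m) (hdm : d ≤ m)
    (hmeas : HasMeasurableSuprema D m ((fun h : X → ℝ => lossOf (B := B) h) '' H))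
    (δ : ℝ) (hδ : 0 < δ) :
    1 - δ ≤ (sampleLaw D m).real
      {S : Fin m → X × B | ∀ h ∈ H,
        ((expectedLoss D h : ℝ) : EReal) ≤
          ((empiricalLoss S h : ℝ) : EReal)
            + 2 * (rademacherComplexity D m
                ((fun (h : X → ℝ) (z : X × B) => h z.1) '' H) : EReal)
            + ((2 * M * √(2 * d * Real.log (Real.exp 1 * m / d) / m) : ℝ) : EReal)
            + ((M * √(Real.log (1 / δ) / (2 * m)) : ℝ) : EReal)} := by
  have hm' : (0 : ℝ) < m := by exact_mod_cast hm
  have hBM : ∀ b ∈ B, b.1 ≤ M := fun b hb => hM ▸ le_csSup hBdd ⟨b, hb, rfl⟩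
  have : IsProbabilityMeasure (sampleLaw D m) := by unfold sampleLaw; infer_instance
  obtain ⟨z₀⟩ : Nonempty (X × B) := nonempty_of_isProbabilityMeasure D
  have hM0 : 0 ≤ M :=
    ((hB _ z₀.2.2).1.trans (hB _ z₀.2.2).2).trans (hBM _ z₀.2.2)
  rcases H.eq_empty_or_nonempty with rfl | hne
  · simp [hδ.le]
  rcases le_or_gt 1 δ with hδ1 | hδ1
  · exact (sub_nonpos.2 hδ1).trans measureReal_nonneg
  have : Nonempty H := hne.to_subtype
  set R := rademacherComplexity D m ((fun (h : X → ℝ) (z : X × B) => h z.1) '' H) with hR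
  have hlM : ∀ (h : H) (z : X × B), lossOf (h : X → ℝ) z ∈ Set.Icc (-M) 0 := fun h z =>
    auctionLoss_mem_Icc (hB _ z.2.2).1 (hB _ z.2.2).2 (hBM _ z.2.2)
  -- For `M = 0` all losses vanish; `generalization_bound` needs `M > 0`.
  rcases hM0.eq_or_lt with hM0' | hMpos
  · have hzero : ∀ (h : H) (z : X × B), lossOf (h : X → ℝ) z = 0 := fun h z =>
      le_antisymm (hlM h z).2 (by simpa [← hM0'] using (hlM h z).1)
    refine (sub_le_self 1 hδ.le).trans (probReal_univ (μ := sampleLaw D m) ▸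
      measureReal_mono fun S _ h hh => ?_)
    have h0 := hzero ⟨h, hh⟩
    simp only at h0
    simp only [expectedLoss, empiricalLoss, h0, ← hM0']
    simp only [integral_zero, Finset.sum_const_zero, mul_zero, zero_mul, EReal.coe_zero,
      add_zero, zero_add]
    exact mul_nonneg (by norm_num) (EReal.coe_ennreal_nonneg R)
  have hK : ∀ (h : H) (z : X × B), |lossOf (h : X → ℝ) z| ≤ M := fun h z =>
    abs_le.2 ⟨(hlM h z).1, (hlM h z).2.trans hMpos.le⟩
  have hl : ∀ h : H, Measurable (lossOf (B := B) (h : X → ℝ)) := fun h =>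
    measurable_lossOf (hH h h.2)
  have hU : ∀ σ : Fin m → ℤˣ, AEMeasurable (fun S : Fin m → X × B =>
      ⨆ h : H, ∑ i, ((σ i : ℤ) : ℝ) * lossOf (h : X → ℝ) (S i)) (Measure.pi fun _ => D) := by
    intro σ
    refine ((measurable_ereal_toReal.comp_aemeasurable (hmeas.1 σ)).const_mul (m : ℝ)).congr
      (Filter.Eventually.of_forall fun S => ?_)
    have hb : BddAbove (Set.range fun h : H =>
        1 / (m : ℝ) * ∑ i, ((σ i : ℤ) : ℝ) * lossOf (h : X → ℝ) (S i)) :=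
      (bddAbove_range_of_abs_le fun h : H => abs_sum_signs_le σ fun i => hK h (S i)).range_comp_left
        (fun _ _ hab => mul_le_mul_of_nonneg_left hab (by positivity))
    simp only [Function.comp, signedSup]
    rw [biSup_image_coe H (fun h => lossOf (B := B) h)
      (fun g => 1 / (m : ℝ) * ∑ i, ((σ i : ℤ) : ℝ) * g (S i)) hb, EReal.toReal_coe,
      ← Real.mul_iSup_of_nonneg (by positivity)]
    field_simp
  have hF : AEMeasurable (fun S : Fin m → X × B => ⨆ h : H,
      (m * ∫ z, lossOf (h : X → ℝ) z ∂D - ∑ i, lossOf (h : X → ℝ) (S i)))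
      (Measure.pi fun _ => D) := by
    refine ((measurable_ereal_toReal.comp_aemeasurable hmeas.2).const_mul (m : ℝ)).congr
      (Filter.Eventually.of_forall fun S => ?_)
    have heq : ∀ h : H, ∫ z, lossOf (h : X → ℝ) z ∂D - 1 / (m : ℝ) * ∑ i, lossOf (h : X → ℝ) (S i) =
        1 / (m : ℝ) * (m * ∫ z, lossOf (h : X → ℝ) z ∂D - ∑ i, lossOf (h : X → ℝ) (S i)) := by
      intro h; field_simp
    have hb : BddAbove (Set.range fun h : H =>
        ∫ z, lossOf (h : X → ℝ) z ∂D - 1 / (m : ℝ) * ∑ i, lossOf (h : X → ℝ) (S i)) := by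
      simp_rw [heq]
      exact (bddAbove_range_of_abs_le fun h : H =>
        abs_mul_integral_sub_sum_le D (hK h) S).range_comp_left
        (fun _ _ hab => mul_le_mul_of_nonneg_left hab (by positivity))
    simp only [Function.comp]
    rw [biSup_image_coe H (fun h => lossOf (B := B) h)
      (fun g => ∫ z, g z ∂D - 1 / (m : ℝ) * ∑ i, g (S i)) hb, EReal.toReal_coe]
    simp_rw [heq]
    rw [← Real.mul_iSup_of_nonneg (by positivity)]
    field_simp
  have hgen := generalization_bound D hm hMpos (fun (h : H) => lossOf (B := B) (h : X → ℝ))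
    hl hlM hU hF hδ hδ1
  refine hgen.trans (measureReal_mono fun S hS h hh => ?_)
  have hSh := hS ⟨h, hh⟩
  set r := ∫ S, ((2 : ℝ) ^ m)⁻¹ * (1 / (m : ℝ) * ∑ σ : Fin m → ℤˣ,
    ⨆ h : H, ∑ i, ((σ i : ℤ) : ℝ) * lossOf (B := B) (h : X → ℝ) (S i)) ∂(Measure.pi fun _ => D) with hr
  set C := M * √(2 * d * Real.log (Real.exp 1 * m / d) / m) with hC
  have hC0 : 0 ≤ C := by positivity
  -- The comparison uses lower integrals, which are monotone without any measurability of the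
  -- empirical complexity of `H`.
  have hrR : ENNReal.ofReal r ≤ R + ENNReal.ofReal C := by
    have hi : Integrable (fun S : Fin m → X × B => ((2 : ℝ) ^ m)⁻¹ * (1 / (m : ℝ) *
        ∑ σ : Fin m → ℤˣ, ⨆ h : H, ∑ i, ((σ i : ℤ) : ℝ) * lossOf (B := B) (h : X → ℝ) (S i)))
        (Measure.pi fun _ => D) :=
      ((integrable_finsetSum _ fun σ _ => integrable_of_abs_le (hU σ) fun S =>
        abs_ciSup_le fun h : H => abs_sum_signs_le σ fun i => hK h (S i)).const_mul _).const_mul _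
    calc ENNReal.ofReal r ≤ _ := ofReal_integral_le_lintegral hi
      _ ≤ ∫⁻ S, ((empiricalRademacher
            ((fun (h : X → ℝ) (z : X × B) => h z.1) '' H) S).toENNReal + ENNReal.ofReal C)
            ∂(sampleLaw D m) :=
          lintegral_mono fun S => ofReal_rademacher_lossOf_le hB hBM hM0 hd.le hm hdm S
      _ = R + ENNReal.ofReal C := by
          rw [lintegral_add_right _ measurable_const, lintegral_const, measure_univ, mul_one]
          rfl
  change ∫ z, lossOf h z ∂D ≤ empiricalLoss S h + 2 * r + M * √(Real.log (1 / δ) / (2 * m)) at hSh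
  rcases eq_or_ne R ⊤ with hRt | hRt
  · rw [hRt, EReal.coe_ennreal_top, EReal.mul_top_of_pos (by norm_num), EReal.coe_add_top,
      EReal.top_add_coe, EReal.top_add_coe]
    exact le_top
  · have hrr : r ≤ R.toReal + C := by
      rw [← ENNReal.ofReal_toReal hRt, ← ENNReal.ofReal_add ENNReal.toReal_nonneg hC0] at hrR
      exact (ENNReal.ofReal_le_ofReal_iff (by positivity)).1 hrR
    have hRc : (R : EReal) = (R.toReal : EReal) := (EReal.coe_ennreal_toReal hRt).symm
    rw [hRc]
    have h2 : (2 : EReal) = ((2 : ℝ) : EReal) := rfl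
    rw [h2, ← EReal.coe_mul, ← EReal.coe_add, ← EReal.coe_add, ← EReal.coe_add,
      EReal.coe_le_coe_iff]
    have hC2 : 2 * M * √(2 * d * Real.log (Real.exp 1 * m / d) / m) = 2 * C := by rw [hC]; ring
    rw [hC2]
    refine hSh.trans ?_
    linarith
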